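/- Let $\mu$ be a locally finite Borel measure on $\mathbb{R}$, $K=\operatorname{supp}\mu$, and $B(x,\rho)=[x-\rho,x+\rho]$. Call $\mu$ *absolutely decaying* if there are $C,\gamma,\rho_0>0$ such that $$\mu\big(B(x,\rho)\cap B(y,\varepsilon\rho)\big)<C\varepsilon^{\gamma}\mu\big(B(x,\rho)\big)\qquad\text{for all } 0<\rho\le\rho_0,\ x\in K,\ y\in\mathbb{R},\ \varepsilon>0 .$$ Say that $\mu$ *satisfies a power law* if there are $\gamma,k_1,k_2,\rho_0>0$ such that $k_1\rho^{\gamma}\le\mu(B(x,\rho))\le k_2\rho^{\gamma}$ for all $x\in K$ and $0<\rho<\rho_0$. (A measure satisfying a power law is absolutely decaying.) Let $S$ be the set of real numbers $x$ such that * $x$ is badly approximable, i.e. there is $c=c(x)>0$ with $|x-p/q|>c/q^2$ for all integers $p$ and all integers $q\ge1$, and * for every integer $b\ge2$ there is $C(x,b)$ such that the base-$b$ expansion of $x$ does not contain more than $C(x,b)$ consecutive identical digits. Then: 1. If $\mu\ne0$ is absolutely decaying, then $S\cap K$ has positive Hausdorff dimension. 2. If $\mu$ satisfies a power law, then $\dim(S\cap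 K)=\dim K$. 3. The middle third Cantor set $\mathbf{C}$ is the support of a locally finite Borel measure satisfying a power law, and $\dim(S\cap\mathbf{C})=\log2/\log3$. Moreover, the set of $x\in\mathbf{C}$ that are normal to no integer base $b\ge2$ has Hausdorff dimension $\log2/\log3$. (Here $x$ is normal to base $b$ if, for every $k\ge1$, every block of $k$ digits from $\{0,\dots,b-1\}$ occurs in the base-$b$ expansion of $x$ with asymptotic frequency $b^{-k}$.) -/

import Mathlib

open MeasureTheory Filter Topology

/-- `μ` is `(C, γ)`-absolutely decaying: there is `ρ₀ > 0` such that for all `0 < ρ ≤ ρ₀`,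
`x ∈ supp μ`, `y ∈ ℝ` and `ε > 0`,
`μ (B(x, ρ) ∩ B(y, ε ρ)) < C ε ^ γ μ (B(x, ρ))`, with closed balls.
It is used for locally finite Borel measures and `C, γ > 0`. -/
def IsAbsolutelyDecayingWith (μ : Measure ℝ) (C γ : ℝ) : Prop :=
  ∃ ρ₀ : ℝ, 0 < ρ₀ ∧ ∀ ρ : ℝ, 0 < ρ → ρ ≤ ρ₀ → ∀ x ∈ μ.support, ∀ y ε : ℝ, 0 < ε →
    μ (Metric.closedBall x ρ ∩ Metric.closedBall y (ε * ρ)) <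
      ENNReal.ofReal (C * ε ^ γ) * μ (Metric.closedBall x ρ)

/-- `μ` is absolutely decaying: it is `(C, γ)`-absolutely decaying for some `C, γ > 0`. -/
def IsAbsolutelyDecaying (μ : Measure ℝ) : Prop :=
  ∃ C γ : ℝ, 0 < C ∧ 0 < γ ∧ IsAbsolutelyDecayingWith μ C γ

/-- `μ` satisfies a power law: there are `γ, k₁, k₂, ρ₀ > 0` such that
`k₁ ρ ^ γ ≤ μ (B(x, ρ)) ≤ k₂ ρ ^ γ` for all `x ∈ supp μ` and `0 < ρ < ρ₀`. -/
def SatisfiesPowerLaw (μ : Measure ℝ) : Prop :=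
  ∃ γ k₁ k₂ ρ₀ : ℝ, 0 < γ ∧ 0 < k₁ ∧ 0 < k₂ ∧ 0 < ρ₀ ∧
    ∀ x ∈ μ.support, ∀ ρ : ℝ, 0 < ρ → ρ < ρ₀ →
      ENNReal.ofReal (k₁ * ρ ^ γ) ≤ μ (Metric.closedBall x ρ) ∧
        μ (Metric.closedBall x ρ) ≤ ENNReal.ofReal (k₂ * ρ ^ γ)

/-- `x` is badly approximable: there is `c > 0` with `|x - p / q| > c / q ^ 2` for all integers
`p` and all positive integers `q`. -/
def IsBadlyApproximable (x : ℝ) : Prop :=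
  ∃ c : ℝ, 0 < c ∧ ∀ (p : ℤ) (q : ℕ), 0 < q → |x - (p : ℝ) / (q : ℝ)| > c / (q : ℝ) ^ 2

/-- The digits `a₁ a₂ a₃ …` (indexed from `0`) in the base-`b` expansion
`x = ⌊x⌋ + ∑ aₙ b⁻ⁿ` of a real number, with infinitely many `aₙ ≠ b - 1`. -/
noncomputable def expansionDigits (x : ℝ) (b : ℕ) [NeZero b] : ℕ → Fin b :=
  Real.digits (Int.fract x) b

/-- The base-`b` expansion of `x` has no block of more than `L` consecutive identical digits,
for some bound `L`. -/
def HasBoundedRuns (x : ℝ) (b : ℕ) [NeZero b] : Prop :=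
  ∃ L : ℕ, ∀ n ℓ : ℕ,
    (∀ i < ℓ, expansionDigits x b (n + i) = expansionDigits x b n) → ℓ ≤ L

/-- `x` is normal to base `b`: every block of `k ≥ 1` digits occurs in the base-`b` expansion of
`x` with asymptotic frequency `1 / b ^ k`. -/
def IsNormalToBase (x : ℝ) (b : ℕ) [NeZero b] : Prop :=
  ∀ k : ℕ, 1 ≤ k → ∀ w : Fin k → Fin b,
    Tendsto
      (fun N : ℕ =>
        (((Finset.range N).filter
          (fun n => ∀ i : Fin k, expansionDigits x b (n + i) = w i)).card : ℝ) / (N : ℝ))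
      atTop (𝓝 (1 / (b : ℝ) ^ k))

/-- The badly approximable reals whose base-`b` expansion has bounded runs of identical digits
for every integer `b ≥ 2` (the bound may depend on the number and on `b`). -/
def badBoundedRunsSet : Set ℝ :=
  {x | IsBadlyApproximable x ∧ ∀ (b : ℕ) [NeZero b], 2 ≤ b → HasBoundedRuns x b}

/-- The reals that are normal to no integer base `b ≥ 2`. -/
def normalToNoBaseSet : Set ℝ :=
  {x | ∀ (b : ℕ) [NeZero b], 2 ≤ b → ¬ IsNormalToBase x b}

/-!
Both conditions defining `badBoundedRunsSet` ask a number `x` to keep a distance comparable to `r`,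
at every scale `r ≤ 1`, from a set of reals that is itself separated at scale `r`. Bad
approximability is about the rationals `p / q` with `q ^ 2 * r ≤ 1`
(`rationalsAtScale_separated`). Bounded runs in base `b` are about the multiples of
`1 / ((b - 1) * b ^ n)` with `b ^ n * r ≤ 1`, because a long run of one digit makes `x` very close
to the number that repeats this digit for ever (`exists_abs_sub_le_of_run`). This makes countably
many families of obstacles.

Fix a ratio `β`. A ball of radius `ρ` meets the neighbourhood of at most one obstacle of one family
at a slightly larger scale, so a set `K` is able to avoid the obstacles if in every ball centred on
`K` one can choose `N` points of `K` that are `β ρ`-separated and far from one given point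
(`EvadesFinsets`). Iterating the choice gives an `N`-ary tree of points of `K`, and its ends form a
set of dimension at least `log N / log β⁻¹`: reading an end as a base-`N` expansion maps it onto
`[0, 1)`, and this map is Hölder (`le_dimH_range_of_separated`). The families take turns: level `k`
deals with the family `j = padicValNat 2 (k + 1)`. The turns of each family come at bounded gaps,
which changes its constant only (`EvadesFinsets.le_dimH_families`).

If `μ` decays with exponent `γ`, then `N` balls of radius `3 β ρ` fail to cover the support as long
as `N β ^ γ` is small; taking `β = N ^ (-1 / s)` with `s < γ` and `N` large gives dimension at least
`s`, hence at least `γ` (`IsAbsolutelyDecayingWith.le_dimH`). A power law with exponent `γ` implies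
decay with the same exponent, and by a packing argument the support has dimension at most `γ`
(`SatisfiesPowerLawWith.dimH_support_le`), so everything has dimension exactly `γ`. The law of
independent fair ternary digits `0` and `2` satisfies a power law with exponent `log 2 / log 3` on
the Cantor set. Finally, a number with bounded runs in base `b` is not normal to base `b`.
-/

/-! ### Trees of separated points -/

/-- Inside the half-size ball around any point of `K`, at every scale `ρ ≤ ρ₀`, one can find a
point of `K` that is `3 β ρ`-far from any prescribed set of at most `N` reals. -/
def EvadesFinsets (K : Set ℝ) (ρ₀ β : ℝ) (N : ℕ) : Prop :=
  ∀ x ∈ K, ∀ ρ : ℝ, 0 < ρ → ρ ≤ ρ₀ → ∀ F : Finset ℝ, F.card ≤ N →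
    ∃ y ∈ K, |y - x| ≤ ρ / 2 ∧ ∀ f ∈ F, 3 * β * ρ < |y - f|

/-- Choosing points greedily, a set that evades `N` points contains `N` separated points close to
a given one, all of them far from a given real `z`. -/
theorem EvadesFinsets.exists_separated {K : Set ℝ} {ρ₀ β : ℝ} {N : ℕ}
    (h : EvadesFinsets K ρ₀ β N) {x : ℝ} (hx : x ∈ K) {ρ : ℝ} (hρ : 0 < ρ) (hρ' : ρ ≤ ρ₀) (z : ℝ) :
    ∃ c : Fin N → ℝ, (∀ i, c i ∈ K ∧ |c i - x| ≤ ρ / 2 ∧ 3 * β * ρ < |c i - z|) ∧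
      ∀ i j, i ≠ j → 3 * β * ρ < |c i - c j| := by
  classical
  have key : ∀ n ≤ N, ∃ c : ℕ → ℝ,
      (∀ i < n, c i ∈ K ∧ |c i - x| ≤ ρ / 2 ∧ 3 * β * ρ < |c i - z|) ∧
      ∀ i < n, ∀ j < i, 3 * β * ρ < |c i - c j| := by
    intro n
    induction n with
    | zero => intro _; exact ⟨fun _ => 0, by simp, by simp⟩
    | succ n ih =>
      intro hn
      obtain ⟨c, hc, hcc⟩ := ih (by omega)
      obtain ⟨y, hyK, hyx, hyF⟩ := h x hx ρ hρ hρ' (insert z ((Finset.range n).image c))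
        ((Finset.card_insert_le _ _).trans (by
          have := Finset.card_image_le (s := Finset.range n) (f := c)
          simp only [Finset.card_range] at this
          omega))
      refine ⟨Function.update c n y, fun i hi => ?_, fun i hi j hj => ?_⟩
      · rcases eq_or_ne i n with rfl | hne
        · simpa using ⟨hyK, hyx, hyF z (by simp)⟩
        · simpa [hne] using hc i (by omega)
      · have hjn : j ≠ n := by omega
        rcases eq_or_ne i n with rfl | hne
        · simpa [hjn] using hyF (c j) (by
            simp only [Finset.mem_insert, Finset.mem_image, Finset.mem_range]
            exact Or.inr ⟨j, hj, rfl⟩)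
        · simpa [hne, hjn] using hcc i (by omega) j hj
  obtain ⟨c, hc, hcc⟩ := key N le_rfl
  refine ⟨fun i => c i, fun i => hc i i.2, fun i j hij => ?_⟩
  rcases lt_or_gt_of_ne (Fin.val_ne_of_ne hij) with hlt | hlt
  · rw [abs_sub_comm]
    exact hcc j j.2 i hlt
  · exact hcc i i.2 j hlt

/-- A family of reals indexed by the ends of the `N`-ary tree, in which ends that separate at
level `k` give points at distance at least `a β ^ (k + 1)`, has dimension at least
`log N / log β⁻¹`: reading ends as base-`N` expansions is a Hölder map onto `[0, 1)`. -/
theorem le_dimH_range_of_separated {N : ℕ} (hN : 2 ≤ N) {a β : ℝ} (ha : 0 < a) (hβ : 0 < β)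
    (hβ1 : β < 1) (g : (ℕ → Fin N) → ℝ)
    (hg : ∀ u v : ℕ → Fin N, ∀ k, (∀ i < k, u i = v i) → u k ≠ v k →
      a * β ^ (k + 1) ≤ |g u - g v|) :
    ENNReal.ofReal (Real.log N / Real.log β⁻¹) ≤ dimH (Set.range g) := by
  have hN0 : NeZero N := ⟨by omega⟩
  have hN1 : (1 : ℝ) < N := by exact_mod_cast (by omega : 1 < N)
  set s : ℝ := Real.log N / Real.log β⁻¹ with hs
  have hlogβ : 0 < Real.log β⁻¹ := Real.log_pos ((one_lt_inv₀ hβ).2 hβ1)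
  have hspos : 0 < s := div_pos (Real.log_pos hN1) hlogβ
  have hinj : Function.Injective g := by
    intro u v huv
    by_contra hne
    have hex : ∃ k, u k ≠ v k := Function.ne_iff.1 hne
    have := hg u v (Nat.find hex) (fun i hi => by simpa using Nat.find_min hex hi)
      (Nat.find_spec hex)
    rw [huv, sub_self, abs_zero] at this
    have : 0 < a * β ^ (Nat.find hex + 1) := by positivity
    linarith
  have hβs : β ^ s = (N : ℝ)⁻¹ := by
    rw [Real.rpow_def_of_pos hβ, hs, Real.log_inv, div_neg, mul_neg,
      mul_div_cancel₀ _ (by rw [Real.log_inv] at hlogβ; linarith), Real.exp_neg,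
      Real.exp_log (by linarith)]
  set φ : ℝ → ℝ := fun x => Real.ofDigits (Function.invFun g x) with hφ
  have hφg : ∀ u, φ (g u) = Real.ofDigits u := fun u => by
    simp only [hφ, Function.leftInverse_invFun hinj u]
  have hC : 0 ≤ (a * β) ^ (-s) := by positivity
  have hold : HolderOnWith ((a * β) ^ (-s)).toNNReal s.toNNReal φ (Set.range g) := by
    rintro _ ⟨u, rfl⟩ _ ⟨v, rfl⟩
    rcases eq_or_ne u v with rfl | hne
    · simp
    have hex : ∃ k, u k ≠ v k := Function.ne_iff.1 hne
    set m := Nat.find hex with hm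
    have hlt : ∀ i < m, u i = v i := fun i hi => by simpa using Nat.find_min hex hi
    have h1 := hg u v m hlt (Nat.find_spec hex)
    have h2 := Real.abs_ofDigits_sub_ofDigits_le hlt
    have h3 : |Real.ofDigits u - Real.ofDigits v| ≤ (a * β) ^ (-s) * |g u - g v| ^ s := by
      calc |Real.ofDigits u - Real.ofDigits v| ≤ ((N : ℝ) ^ m)⁻¹ := h2
        _ = (a * β) ^ (-s) * (a * β ^ (m + 1)) ^ s := by
          rw [pow_succ', ← mul_assoc, Real.mul_rpow (x := a * β) (y := β ^ m) (by positivity)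
              (by positivity), ← mul_assoc,
            ← Real.rpow_add (by positivity), neg_add_cancel, Real.rpow_zero, one_mul,
            ← Real.rpow_natCast β m, ← Real.rpow_mul hβ.le, mul_comm, Real.rpow_mul hβ.le, hβs,
            Real.rpow_natCast, inv_pow]
        _ ≤ _ := by gcongr
    rw [hφg, hφg, edist_dist, edist_dist, Real.dist_eq, Real.dist_eq,
      ENNReal.ofReal_rpow_of_nonneg (abs_nonneg _) (by positivity), Real.coe_toNNReal _ hspos.le,
      ← ENNReal.ofReal_coe_nnreal, Real.coe_toNNReal _ hC, ← ENNReal.ofReal_mul hC]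
    exact ENNReal.ofReal_le_ofReal h3
  have himg : Set.Ico (0 : ℝ) 1 ⊆ φ '' Set.range g := fun t ht =>
    ⟨g (Real.digits t N), ⟨_, rfl⟩, by rw [hφg, Real.ofDigits_digits (by omega) ht]⟩
  have h1 : dimH (Set.Ico (0 : ℝ) 1) = 1 := by
    have := Real.dimH_of_nonempty_interior (E := ℝ) (s := Set.Ico (0 : ℝ) 1) (by simp)
    simpa using this
  have h2 := hold.dimH_image_le (Real.toNNReal_pos.2 hspos)
  have h3 : (1 : ENNReal) ≤ dimH (Set.range g) / (s.toNNReal : ENNReal) :=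
    h1 ▸ (dimH_mono himg).trans h2
  have h4 := (ENNReal.le_div_iff_mul_le (Or.inl (by simpa using hspos))
    (Or.inl ENNReal.coe_ne_top)).1 h3
  rwa [one_mul] at h4

/-- If `K` evades `N` points, its points that stay `ρ₀ β ^ (k + 1)`-far from a
`4 ρ₀ β ^ k`-separated set `Z k` for every `k` form a set of dimension at least
`log N / log β⁻¹`. A ball of radius `ρ₀ β ^ k` meets the neighbourhood of at most one point of
`Z k`, so `N` of its sub-balls of radius `ρ₀ β ^ (k + 1)` can be kept. -/
theorem EvadesFinsets.le_dimH_avoiding {K : Set ℝ} {ρ₀ β : ℝ} {N : ℕ}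
    (h : EvadesFinsets K ρ₀ β N) (hK : IsClosed K) (hne : K.Nonempty) (hρ₀ : 0 < ρ₀)
    (hβ : 0 < β) (hβ3 : β ≤ 1 / 3) (hN : 2 ≤ N) (Z : ℕ → Set ℝ)
    (hZ : ∀ k, ∀ e ∈ Z k, ∀ e' ∈ Z k, e ≠ e' → 4 * (ρ₀ * β ^ k) < |e - e'|) :
    ENNReal.ofReal (Real.log N / Real.log β⁻¹) ≤
      dimH {x | x ∈ K ∧ ∀ k, ∀ e ∈ Z k, ρ₀ * β ^ (k + 1) ≤ |x - e|} := by
  have hpos : ∀ k, 0 < ρ₀ * β ^ k := fun k => by positivity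
  have hle : ∀ k, ρ₀ * β ^ k ≤ ρ₀ := fun k =>
    mul_le_of_le_one_right hρ₀.le (pow_le_one₀ hβ.le (by linarith))
  have hchild : ∀ k x, x ∈ K → ∃ c : Fin N → ℝ,
      (∀ i, c i ∈ K ∧ |c i - x| ≤ ρ₀ * β ^ k / 2 ∧
        ∀ e ∈ Z k, |x - e| ≤ 2 * (ρ₀ * β ^ k) → 3 * (ρ₀ * β ^ (k + 1)) < |c i - e|) ∧
      ∀ i j, i ≠ j → 3 * (ρ₀ * β ^ (k + 1)) < |c i - c j| := by
    intro k x hx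
    have hscale : 3 * (ρ₀ * β ^ (k + 1)) = 3 * β * (ρ₀ * β ^ k) := by ring
    rw [hscale]
    by_cases hz : ∃ z ∈ Z k, |x - z| ≤ 2 * (ρ₀ * β ^ k)
    · obtain ⟨z, hzZ, hzx⟩ := hz
      obtain ⟨c, hc, hcc⟩ := h.exists_separated hx (hpos k) (hle k) z
      refine ⟨c, fun i => ⟨(hc i).1, (hc i).2.1, fun e he hex => ?_⟩, hcc⟩
      obtain rfl : e = z := by
        by_contra hez
        have h1 := hZ k e he z hzZ hez
        have h2 := abs_sub_le e x z
        rw [abs_sub_comm e x] at h2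
        linarith
      exact (hc i).2.2
    · obtain ⟨c, hc, hcc⟩ := h.exists_separated hx (hpos k) (hle k) 0
      exact ⟨c, fun i => ⟨(hc i).1, (hc i).2.1, fun e he hex => (hz ⟨e, he, hex⟩).elim⟩, hcc⟩
  choose! c hcK hcc using hchild
  obtain ⟨x₀, hx₀⟩ := hne
  let X : (ℕ → Fin N) → ℕ → ℝ := fun u k => Nat.rec x₀ (fun k x => c k x (u k)) k
  have hXs : ∀ u k, X u (k + 1) = c k (X u k) (u k) := fun u k => rfl
  have hXK : ∀ u k, X u k ∈ K := by
    intro u k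
    induction k with
    | zero => exact hx₀
    | succ k ih => exact (hcK k _ ih (u k)).1
  have hstep : ∀ u k, dist (X u k) (X u (k + 1)) ≤ ρ₀ / 2 * β ^ k := by
    intro u k
    rw [dist_comm, Real.dist_eq, hXs]
    have := (hcK k _ (hXK u k) (u k)).2.1
    linarith
  have hβ1 : β < 1 := by linarith
  have hlim : ∀ u, ∃ y, Tendsto (X u) atTop (𝓝 y) := fun u =>
    cauchySeq_tendsto_of_complete (cauchySeq_of_le_geometric β (ρ₀ / 2) hβ1 (hstep u))
  choose g hg using hlim
  have hgK : ∀ u, g u ∈ K := fun u => hK.mem_of_tendsto (hg u) (Eventually.of_forall (hXK u))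
  have hgX : ∀ u k, |X u k - g u| ≤ ρ₀ * β ^ k := by
    intro u k
    have h1 := dist_le_of_le_geometric_of_tendsto β (ρ₀ / 2) hβ1 (hstep u) (hg u) k
    rw [Real.dist_eq] at h1
    refine h1.trans ?_
    rw [div_le_iff₀ (by linarith)]
    nlinarith [hpos k]
  refine (le_dimH_range_of_separated hN hρ₀ hβ hβ1 g ?_).trans (dimH_mono ?_)
  · intro u v k huv hk
    have hX : X u k = X v k := by
      have : ∀ j ≤ k, X u j = X v j := by
        intro j
        induction j with
        | zero => intro _; rfl
        | succ j ih => intro hj; rw [hXs, hXs, ih (by omega), huv j (by omega)]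
      exact this k le_rfl
    have h1 := hcc k _ (hXK u k) (u k) (v k) hk
    have h2 := hgX u (k + 1)
    have h3 := hgX v (k + 1)
    rw [hXs] at h2 h3
    rw [← hX] at h3
    have h4 := abs_sub_le (c k (X u k) (u k)) (g u) (c k (X u k) (v k))
    have h5 := abs_sub_le (g u) (g v) (c k (X u k) (v k))
    rw [abs_sub_comm (g v)] at h5
    linarith
  · rintro _ ⟨u, rfl⟩
    refine ⟨hgK u, fun k e he => ?_⟩
    by_cases hex : |X u k - e| ≤ 2 * (ρ₀ * β ^ k)
    · have h1 := (hcK k _ (hXK u k) (u k)).2.2 e he hex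
      rw [← hXs] at h1
      have h2 := hgX u (k + 1)
      have h3 := abs_sub_le (X u (k + 1)) (g u) e
      have := hpos (k + 1)
      linarith
    · have h2 := hgX u k
      have h3 := abs_sub_le (X u k) (g u) e
      have : ρ₀ * β ^ (k + 1) ≤ ρ₀ * β ^ k := by
        rw [pow_succ, ← mul_assoc]
        exact mul_le_of_le_one_right (hpos k).le hβ1.le
      linarith

/-! ### Countably many families of points to avoid -/

/-- Every window of length `3 * 2 ^ j` contains an index `k` assigned to the family `j` by
`k ↦ padicValNat 2 (k + 1)`. -/
theorem exists_padicValNat_two_succ_eq (j n : ℕ) :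
    ∃ k, n ≤ k ∧ k ≤ n + 3 * 2 ^ j ∧ padicValNat 2 (k + 1) = j := by
  have h2 : 0 < 2 ^ j := by positivity
  set i := n / 2 ^ (j + 1) + 1 with hi
  have hlt : n < 2 ^ (j + 1) * i := by
    rw [hi, mul_comm]
    exact (Nat.div_lt_iff_lt_mul (by positivity)).1 (Nat.lt_succ_self _)
  have hle : 2 ^ (j + 1) * i ≤ n + 2 ^ (j + 1) := by
    have := Nat.div_mul_le_self n (2 ^ (j + 1))
    rw [hi]
    nlinarith
  have hk : 2 ^ (j + 1) * i + 2 ^ j = 2 ^ j * (2 * i + 1) := by ring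
  refine ⟨2 ^ j * (2 * i + 1) - 1, ?_, ?_, ?_⟩
  · omega
  · rw [pow_succ] at hle hk
    omega
  · rw [Nat.sub_add_cancel (Nat.mul_pos h2 (by omega)), padicValNat.mul (by positivity) (by omega),
      padicValNat.prime_pow, padicValNat.eq_zero_of_not_dvd (by omega), add_zero]

/-- If `E j r` are decreasing in the scale `r` and `δ j * r`-separated, a set that evades finsets
contains, with the same dimension bound, points that keep a distance comparable to `r` from every
`E j r`. The family `j` is taken care of at the levels `k` with `padicValNat 2 (k + 1) = j`, whose
gaps are bounded; this costs only a constant depending on `j`. -/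
theorem EvadesFinsets.le_dimH_families {K : Set ℝ} {ρ₀ β : ℝ} {N : ℕ}
    (h : EvadesFinsets K ρ₀ β N) (hK : IsClosed K) (hne : K.Nonempty) (hρ₀ : 0 < ρ₀)
    (hβ : 0 < β) (hβ3 : β ≤ 1 / 3) (hN : 2 ≤ N) (E : ℕ → ℝ → Set ℝ) (hE : ∀ j, Antitone (E j))
    (δ : ℕ → ℝ) (hδ : ∀ j, 0 < δ j)
    (hsep : ∀ j r, 0 < r → ∀ e ∈ E j r, ∀ e' ∈ E j r, e ≠ e' → δ j * r ≤ |e - e'|) :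
    ENNReal.ofReal (Real.log N / Real.log β⁻¹) ≤
      dimH {x | x ∈ K ∧ ∀ j, ∃ c : ℝ, 0 < c ∧
        ∀ r : ℝ, 0 < r → r ≤ 1 → ∀ e ∈ E j r, c * r ≤ |x - e|} := by
  wlog hδρ : ∀ j, δ j ≤ ρ₀ generalizing δ
  · refine this (fun j => min (δ j) ρ₀) (fun j => lt_min (hδ j) hρ₀)
      (fun j r hr e he e' he' hee => le_trans ?_ (hsep j r hr e he e' he' hee))
      (fun j => min_le_right _ _)
    gcongr
    exact min_le_left _ _
  let J : ℕ → ℕ := fun k => padicValNat 2 (k + 1)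
  let R : ℕ → ℝ := fun k => 5 * ρ₀ * β ^ k / δ (J k)
  have hR : ∀ k, 0 < R k := fun k => by have := hδ (J k); positivity
  refine (h.le_dimH_avoiding hK hne hρ₀ hβ hβ3 hN (fun k => E (J k) (R k)) ?_).trans (dimH_mono ?_)
  · intro k e he e' he' hee
    refine lt_of_lt_of_le ?_ (hsep (J k) (R k) (hR k) e he e' he' hee)
    have h1 : δ (J k) * R k = 5 * (ρ₀ * β ^ k) := by
      have := (hδ (J k)).ne'
      simp only [R]
      field_simp
    have : 0 < ρ₀ * β ^ k := by positivity
    rw [h1]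
    linarith
  · rintro x ⟨hxK, hx⟩
    refine ⟨hxK, fun j => ⟨β ^ (3 * 2 ^ j + 2) * δ j / 5, by have := hδ j; positivity,
      fun r hr hr1 e he => ?_⟩⟩
    have hδj := hδ j
    set t := r * δ j / (5 * ρ₀) with ht
    have ht0 : 0 < t := by positivity
    have ht1 : t ≤ 1 := by
      rw [ht, div_le_one (by positivity)]
      nlinarith [hδρ j]
    obtain ⟨n, hn, hn'⟩ := exists_nat_pow_near_of_lt_one ht0 ht1 hβ (by linarith)
    obtain ⟨k, hk1, hk2, hkj⟩ := exists_padicValNat_two_succ_eq j (n + 1)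
    have hβk : β ^ k ≤ t := (pow_le_pow_of_le_one hβ.le (by linarith) hk1).trans hn.le
    have hJ : J k = j := hkj
    have hRr : R k ≤ r := by
      simp only [R, hJ]
      rw [div_le_iff₀ hδj, mul_comm (5 * ρ₀), ← le_div_iff₀ (by positivity)]
      exact hβk
    have h1 := hx k e (by simpa only [hJ] using hE j hRr he)
    refine le_trans ?_ h1
    have h2 : β ^ (3 * 2 ^ j + 2) * β ^ n ≤ β ^ (k + 1) := by
      rw [← pow_add]
      exact pow_le_pow_of_le_one hβ.le (by linarith) (by omega)
    calc β ^ (3 * 2 ^ j + 2) * δ j / 5 * r = ρ₀ * (β ^ (3 * 2 ^ j + 2) * t) := by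
          rw [ht]; field_simp
      _ ≤ ρ₀ * (β ^ (3 * 2 ^ j + 2) * β ^ n) := by gcongr
      _ ≤ _ := by gcongr

/-! ### Rationals and runs of digits -/

/-- The rationals `p / q` with `q ^ 2 * r ≤ 1`. -/
def rationalsAtScale (r : ℝ) : Set ℝ :=
  {e | ∃ (p : ℤ) (q : ℕ), 0 < q ∧ (q : ℝ) ^ 2 * r ≤ 1 ∧ e = p / q}

/-- The points `m / ((b - 1) * b ^ n)` with `b ^ n * r ≤ 1`: the reals whose base-`b` expansion is
eventually constant from a position `n` on, at scale `r`. -/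
def constantTailsAtScale (b : ℕ) (r : ℝ) : Set ℝ :=
  {e | ∃ (m : ℤ) (n : ℕ), (b : ℝ) ^ n * r ≤ 1 ∧ e = m / (((b : ℝ) - 1) * (b : ℝ) ^ n)}

theorem antitone_rationalsAtScale : Antitone rationalsAtScale := by
  rintro r r' hrr e ⟨p, q, hq, hqr, rfl⟩
  exact ⟨p, q, hq, le_trans (by gcongr) hqr, rfl⟩

theorem antitone_constantTailsAtScale (b : ℕ) : Antitone (constantTailsAtScale b) := by
  rintro r r' hrr e ⟨m, n, hn, rfl⟩
  exact ⟨m, n, le_trans (by gcongr) hn, rfl⟩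

theorem le_abs_intCast_div_sub {D : ℝ} (hD : 0 < D) {m m' : ℤ}
    (h : (m : ℝ) / D ≠ m' / D) : 1 / D ≤ |(m : ℝ) / D - m' / D| := by
  have hm : m - m' ≠ 0 := fun h0 => h (by rw [sub_eq_zero.1 h0])
  rw [← sub_div, abs_div, abs_of_pos hD]
  gcongr
  exact_mod_cast Int.one_le_abs hm

theorem rationalsAtScale_separated {r : ℝ} (hr : 0 < r) {e e' : ℝ} (he : e ∈ rationalsAtScale r)
    (he' : e' ∈ rationalsAtScale r) (hne : e ≠ e') : r ≤ |e - e'| := by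
  obtain ⟨p, q, hq, hqr, rfl⟩ := he
  obtain ⟨p', q', hq', hqr', rfl⟩ := he'
  have hq0 : (0 : ℝ) < q := by exact_mod_cast hq
  have hq0' : (0 : ℝ) < q' := by exact_mod_cast hq'
  have h1 : (p : ℝ) / q = ((p * q' : ℤ) : ℝ) / (q * q') := by push_cast; field_simp
  have h2 : (p' : ℝ) / q' = ((p' * q : ℤ) : ℝ) / (q * q') := by push_cast; field_simp
  rw [h1, h2] at hne ⊢
  refine le_trans ?_ (le_abs_intCast_div_sub (by positivity) hne)
  rw [le_div_iff₀ (by positivity)]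
  nlinarith [mul_nonneg hr.le (sq_nonneg ((q : ℝ) - q'))]

theorem constantTailsAtScale_separated {b : ℕ} (hb : 2 ≤ b) {r : ℝ} (hr : 0 < r) {e e' : ℝ}
    (he : e ∈ constantTailsAtScale b r) (he' : e' ∈ constantTailsAtScale b r) (hne : e ≠ e') :
    1 / ((b : ℝ) - 1) * r ≤ |e - e'| := by
  wlog hnn : ∃ (m m' : ℤ) (n n' : ℕ), n ≤ n' ∧ (b : ℝ) ^ n' * r ≤ 1 ∧
      e = m / (((b : ℝ) - 1) * (b : ℝ) ^ n) ∧ e' = m' / (((b : ℝ) - 1) * (b : ℝ) ^ n')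
    generalizing e e'
  · obtain ⟨m, n, hn, h1⟩ := he
    obtain ⟨m', n', hn', h2⟩ := he'
    rcases le_total n n' with h | h
    · exact (hnn ⟨m, m', n, n', h, hn', h1, h2⟩).elim
    · rw [abs_sub_comm]
      exact this ⟨m', n', hn', h2⟩ ⟨m, n, hn, h1⟩ hne.symm ⟨m', m, n', n, h, hn, h2, h1⟩
  obtain ⟨m, m', n, n', hle, hn', rfl, rfl⟩ := hnn
  have hb1 : (0 : ℝ) < (b : ℝ) - 1 := by
    have : (2 : ℝ) ≤ b := by exact_mod_cast hb
    linarith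
  have hb0 : (0 : ℝ) < b := by linarith
  have h1 : (m : ℝ) / (((b : ℝ) - 1) * (b : ℝ) ^ n) =
      ((m * b ^ (n' - n) : ℤ) : ℝ) / (((b : ℝ) - 1) * (b : ℝ) ^ n') := by
    rw [← Nat.sub_add_cancel hle, pow_add, Nat.add_sub_cancel]
    push_cast
    field_simp
  rw [h1] at hne ⊢
  refine le_trans ?_ (le_abs_intCast_div_sub (by positivity) hne)
  rw [one_div_mul_eq_div, le_div_iff₀ (by positivity)]
  calc r / ((b : ℝ) - 1) * (((b : ℝ) - 1) * (b : ℝ) ^ n') = (b : ℝ) ^ n' * r := by field_simp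
    _ ≤ 1 := hn'

theorem floor_mul_pow_succ {y : ℝ} {b : ℕ} [NeZero b] (i : ℕ) :
    ⌊y * (b : ℝ) ^ (i + 1)⌋₊ = b * ⌊y * (b : ℝ) ^ i⌋₊ + (Real.digits y b i : ℕ) := by
  have hb : (b : ℝ) ≠ 0 := by exact_mod_cast NeZero.ne b
  have h1 : ⌊y * (b : ℝ) ^ i⌋₊ = ⌊y * (b : ℝ) ^ (i + 1)⌋₊ / b := by
    rw [← Nat.floor_div_natCast, pow_succ, ← mul_assoc, mul_div_cancel_right₀ _ hb]
  rw [h1, Real.digits, Fin.val_ofNat, Nat.div_add_mod]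

/-- A run of `ℓ` equal digits `d` from position `n` on puts `x` within `b ^ -(n + ℓ)` of the real
that continues with the digit `d` for ever, which is a multiple of `1 / ((b - 1) * b ^ n)`. -/
theorem exists_abs_sub_le_of_run {x : ℝ} {b : ℕ} [NeZero b] (hb : 2 ≤ b) {n ℓ : ℕ}
    (hrun : ∀ i < ℓ, expansionDigits x b (n + i) = expansionDigits x b n) :
    ∃ m : ℤ, |x - m / (((b : ℝ) - 1) * (b : ℝ) ^ n)| ≤ 1 / (b : ℝ) ^ (n + ℓ) := by
  set y := Int.fract x with hy
  have hy0 : 0 ≤ y := Int.fract_nonneg x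
  set d : ℕ := (expansionDigits x b n : ℕ) with hd
  have hdb : d < b := (expansionDigits x b n).2
  have hb2 : (2 : ℝ) ≤ b := by exact_mod_cast hb
  have hb1 : (0 : ℝ) < (b : ℝ) - 1 := by linarith
  have hb0 : (0 : ℝ) < b := by linarith
  set f : ℕ → ℝ := fun k => (⌊y * (b : ℝ) ^ k⌋₊ : ℝ) with hf
  have hfl : ∀ j ≤ ℓ, f (n + j) + d / ((b : ℝ) - 1) =
      (b : ℝ) ^ j * (f n + d / ((b : ℝ) - 1)) := by
    intro j
    induction j with
    | zero => intro _; simp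
    | succ j ih =>
      intro hj
      have h1 : f (n + (j + 1)) = b * f (n + j) + d := by
        have h2 : (Real.digits y b (n + j) : ℕ) = d := by
          rw [hd, ← hrun j (by omega)]; rfl
        simp only [hf]
        rw [← add_assoc, floor_mul_pow_succ, h2]
        push_cast
        ring
      rw [h1, pow_succ', mul_assoc, ← ih (by omega)]
      field_simp
      ring
  have h1 : f (n + ℓ) ≤ y * (b : ℝ) ^ (n + ℓ) := Nat.floor_le (by positivity)
  have h2 : y * (b : ℝ) ^ (n + ℓ) < f (n + ℓ) + 1 := Nat.lt_floor_add_one _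
  have h3 : 0 ≤ d / ((b : ℝ) - 1) := by positivity
  have h4 : d / ((b : ℝ) - 1) ≤ 1 := by
    rw [div_le_one hb1]
    have : (d : ℝ) + 1 ≤ b := by exact_mod_cast hdb
    linarith
  refine ⟨⌊x⌋ * ((b - 1) * b ^ n) + ((b - 1) * ⌊y * (b : ℝ) ^ n⌋₊ + d), ?_⟩
  have h5 : x - ((⌊x⌋ * ((b - 1) * b ^ n) + ((b - 1) * ⌊y * (b : ℝ) ^ n⌋₊ + d) : ℤ) : ℝ) /
      (((b : ℝ) - 1) * (b : ℝ) ^ n) =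
      (y * (b : ℝ) ^ (n + ℓ) - (f (n + ℓ) + d / ((b : ℝ) - 1))) / (b : ℝ) ^ (n + ℓ) := by
    have hxy : x = ⌊x⌋ + y := (Int.floor_add_fract x).symm
    rw [hfl ℓ le_rfl]
    simp only [hf]
    push_cast
    generalize (⌊x⌋ : ℝ) = z at hxy ⊢
    generalize (⌊y * (b : ℝ) ^ n⌋₊ : ℝ) = F
    rw [hxy, pow_add]
    field_simp
    ring
  rw [h5, abs_div, abs_of_pos (by positivity : (0 : ℝ) < (b : ℝ) ^ (n + ℓ))]
  gcongr
  rw [abs_le]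
  constructor <;> linarith

theorem hasBoundedRuns_of_far {x : ℝ} {b : ℕ} [NeZero b] (hb : 2 ≤ b) {c : ℝ} (hc : 0 < c)
    (h : ∀ (m : ℤ) (n : ℕ), c / (b : ℝ) ^ n ≤ |x - m / (((b : ℝ) - 1) * (b : ℝ) ^ n)|) :
    HasBoundedRuns x b := by
  have hb2 : (2 : ℝ) ≤ b := by exact_mod_cast hb
  have hb0 : (0 : ℝ) < b := by linarith
  obtain ⟨L, hL⟩ := exists_pow_lt_of_lt_one hc (inv_lt_one_of_one_lt₀ (by linarith : (1 : ℝ) < b))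
  refine ⟨L, fun n ℓ hrun => ?_⟩
  by_contra! hlt
  obtain ⟨m, hm⟩ := exists_abs_sub_le_of_run hb hrun
  have h1 := (h m n).trans hm
  have h2 : c ≤ ((b : ℝ)⁻¹) ^ ℓ := by
    rw [pow_add, div_le_div_iff₀ (by positivity) (by positivity)] at h1
    rw [inv_pow, ← one_div, le_div_iff₀ (by positivity)]
    have : (0 : ℝ) < (b : ℝ) ^ n := by positivity
    nlinarith
  have h3 : ((b : ℝ)⁻¹) ^ ℓ ≤ ((b : ℝ)⁻¹) ^ L :=
    pow_le_pow_of_le_one (by positivity) (inv_le_one_of_one_le₀ (by linarith)) hlt.le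
  linarith

/-- A set that evades finsets contains numbers in `badBoundedRunsSet`, with the dimension bound of
the tree of separated points. -/
theorem EvadesFinsets.le_dimH_badBoundedRunsSet {K : Set ℝ} {ρ₀ β : ℝ} {N : ℕ}
    (h : EvadesFinsets K ρ₀ β N) (hK : IsClosed K) (hne : K.Nonempty) (hρ₀ : 0 < ρ₀)
    (hβ : 0 < β) (hβ3 : β ≤ 1 / 3) (hN : 2 ≤ N) :
    ENNReal.ofReal (Real.log N / Real.log β⁻¹) ≤ dimH (K ∩ badBoundedRunsSet) := by
  -- Bases are at least `2`, which leaves the index `0` free for the rationals.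
  refine (h.le_dimH_families hK hne hρ₀ hβ hβ3 hN
    (fun j => if j < 2 then rationalsAtScale else constantTailsAtScale j) ?_
    (fun j => if j < 2 then 1 else 1 / ((j : ℝ) - 1)) ?_ ?_).trans (dimH_mono ?_)
  · intro j
    split_ifs
    exacts [antitone_rationalsAtScale, antitone_constantTailsAtScale j]
  · intro j
    split_ifs with hj
    · exact one_pos
    · have : (2 : ℝ) ≤ j := by exact_mod_cast not_lt.1 hj
      exact one_div_pos.2 (by linarith)
  · intro j r hr e he e' he' hee
    split_ifs at he he' ⊢ with hj
    · rw [one_mul]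
      exact rationalsAtScale_separated hr he he' hee
    · exact constantTailsAtScale_separated (not_lt.1 hj) hr he he' hee
  · rintro x ⟨hxK, hx⟩
    refine ⟨hxK, ?_, fun b _ hb => ?_⟩
    · obtain ⟨c, hc, hcx⟩ := hx 0
      refine ⟨c / 2, by positivity, fun p q hq => ?_⟩
      have hq1 : (1 : ℝ) ≤ q := by exact_mod_cast hq
      have h1 := hcx (1 / (q : ℝ) ^ 2) (by positivity)
        ((div_le_one (by positivity)).2 (one_le_pow₀ hq1)) (p / q)
        (by
          rw [if_pos (by norm_num)]
          exact ⟨p, q, hq, by rw [mul_one_div_cancel (by positivity)], rfl⟩)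
      rw [mul_one_div] at h1
      refine lt_of_lt_of_le ?_ h1
      gcongr
      linarith
    · obtain ⟨c, hc, hcx⟩ := hx b
      have hb1 : (1 : ℝ) ≤ b := by exact_mod_cast (by omega : 1 ≤ b)
      refine hasBoundedRuns_of_far hb hc fun m n => ?_
      rw [← mul_one_div]
      refine hcx (1 / (b : ℝ) ^ n) (by positivity)
        ((div_le_one (by positivity)).2 (one_le_pow₀ hb1)) _ ?_
      rw [if_neg (by omega)]
      exact ⟨m, n, by rw [mul_one_div_cancel (by positivity)], rfl⟩

/-! ### Decaying measures -/

/-- A decaying measure gives balls of relative radius `6 β` so little mass that `N` of them do not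
cover the support near any of its points. -/
theorem IsAbsolutelyDecayingWith.exists_evadesFinsets {μ : Measure ℝ}
    {C γ : ℝ} (hC : 0 < C) (h : IsAbsolutelyDecayingWith μ C γ) :
    ∃ ρ₀ : ℝ, 0 < ρ₀ ∧ ∀ β : ℝ, 0 < β → ∀ N : ℕ, N * (C * (6 * β) ^ γ) ≤ 1 →
      EvadesFinsets μ.support ρ₀ β N := by
  obtain ⟨ρ₀, hρ₀, hμ⟩ := h
  refine ⟨ρ₀, hρ₀, fun β hβ N hN x hx ρ hρ hρ' F hF => ?_⟩
  by_contra! hcon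
  set B := Metric.closedBall x (ρ / 2) with hB
  have hBpos : 0 < μ B := (μ.mem_support_iff_forall x).1 hx B
    (Metric.closedBall_mem_nhds x (by positivity))
  have hcover : B ⊆ μ.supportᶜ ∪ ⋃ f ∈ F, (B ∩ Metric.closedBall f (6 * β * (ρ / 2))) := by
    intro y hy
    by_cases hyK : y ∈ μ.support
    · obtain ⟨f, hf, hfy⟩ := hcon y hyK (by simpa [hB, Real.dist_eq] using hy)
      refine Or.inr (Set.mem_biUnion hf ⟨hy, ?_⟩)
      rw [Metric.mem_closedBall, Real.dist_eq]
      linarith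
    · exact Or.inl hyK
  have h1 : μ B ≤ ∑ f ∈ F, μ (B ∩ Metric.closedBall f (6 * β * (ρ / 2))) := by
    calc μ B ≤ μ (μ.supportᶜ) + μ (⋃ f ∈ F, (B ∩ Metric.closedBall f (6 * β * (ρ / 2)))) :=
          (measure_mono hcover).trans (measure_union_le _ _)
      _ ≤ _ := by
          rw [Measure.measure_compl_support, zero_add]
          exact measure_biUnion_finset_le _ _
  have hFne : F.Nonempty := by
    rw [Finset.nonempty_iff_ne_empty]
    rintro rfl
    simp only [Finset.sum_empty, nonpos_iff_eq_zero] at h1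
    exact hBpos.ne' h1
  have h2 : ∑ f ∈ F, μ (B ∩ Metric.closedBall f (6 * β * (ρ / 2))) <
      ∑ _f ∈ F, ENNReal.ofReal (C * (6 * β) ^ γ) * μ B :=
    ENNReal.sum_lt_sum_of_nonempty hFne fun f _ =>
      hμ (ρ / 2) (by positivity) (by linarith) x hx f (6 * β) (by positivity)
  have h3 : ∑ _f ∈ F, ENNReal.ofReal (C * (6 * β) ^ γ) * μ B ≤ μ B := by
    rw [Finset.sum_const, nsmul_eq_mul, ← mul_assoc]
    refine mul_le_of_le_one_left' ?_
    rw [← ENNReal.ofReal_natCast, ← ENNReal.ofReal_mul (by positivity)]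
    refine ENNReal.ofReal_le_one.2 (le_trans ?_ hN)
    gcongr
  exact absurd (h1.trans_lt (h2.trans_le h3)) (lt_irrefl _)

/-- The dimension bound for a measure that decays with exponent `γ`: for `s < γ`, trees with
`N` children per node and ratio `β = N ^ (-1 / s)` exist as soon as `N` is large. -/
theorem IsAbsolutelyDecayingWith.le_dimH {μ : Measure ℝ} (hμ : μ ≠ 0)
    {C γ : ℝ} (hC : 0 < C) (hγ : 0 < γ) (h : IsAbsolutelyDecayingWith μ C γ) :
    ENNReal.ofReal γ ≤ dimH (μ.support ∩ badBoundedRunsSet) := by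
  obtain ⟨ρ₀, hρ₀, hev⟩ := h.exists_evadesFinsets hC
  have key : ∀ s : ℝ, 0 < s → s < γ →
      ENNReal.ofReal s ≤ dimH (μ.support ∩ badBoundedRunsSet) := by
    intro s hs hsγ
    have hT : Tendsto (fun N : ℕ => C * 6 ^ γ * (N : ℝ) ^ (-(γ / s - 1))) atTop
        (𝓝 (C * 6 ^ γ * 0)) :=
      ((tendsto_rpow_neg_atTop (by rw [sub_pos, one_lt_div hs]; exact hsγ)).comp
        tendsto_natCast_atTop_atTop).const_mul _
    have hT' : Tendsto (fun N : ℕ => (N : ℝ) ^ (-(1 / s))) atTop (𝓝 0) :=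
      (tendsto_rpow_neg_atTop (by positivity)).comp tendsto_natCast_atTop_atTop
    rw [mul_zero] at hT
    obtain ⟨N, hN1, hN2, hN3⟩ := ((hT.eventually_le_const one_pos).and
      ((hT'.eventually_le_const (by norm_num : (0 : ℝ) < 1 / 3)).and (eventually_ge_atTop 2))).exists
    have hN0 : (0 : ℝ) < N := by exact_mod_cast (by omega : 0 < N)
    have hN1' : (1 : ℝ) < N := by exact_mod_cast (by omega : 1 < N)
    set β : ℝ := (N : ℝ) ^ (-(1 / s)) with hβ
    have hβ0 : 0 < β := by positivity
    have hNβ : N * (C * (6 * β) ^ γ) ≤ 1 := by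
      refine le_trans (le_of_eq ?_) hN1
      rw [Real.mul_rpow (by norm_num) hβ0.le, hβ, ← Real.rpow_mul hN0.le]
      have : (N : ℝ) ^ (-(γ / s - 1)) = N * (N : ℝ) ^ (-(1 / s) * γ) := by
        rw [← Real.rpow_one_add' hN0.le]
        · congr 1; ring
        · have : 1 < γ / s := (one_lt_div hs).2 hsγ
          have h2 : 1 + -(1 / s) * γ = 1 - γ / s := by ring
          rw [h2]
          linarith
      rw [this]
      ring
    have h1 := (hev β hβ0 N hNβ).le_dimH_badBoundedRunsSet Measure.isClosed_support
      (Measure.nonempty_support hμ) hρ₀ hβ0 hN2 hN3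
    have h2 : Real.log N / Real.log β⁻¹ = s := by
      rw [hβ, ← Real.rpow_neg hN0.le, neg_neg, Real.log_rpow hN0]
      have := (Real.log_pos hN1').ne'
      field_simp
    rwa [h2] at h1
  refine le_of_forall_lt_imp_le_of_dense fun a ha => ?_
  have hat : a ≠ ⊤ := (ha.trans ENNReal.ofReal_lt_top).ne
  have haγ : a.toReal < γ := (ENNReal.lt_ofReal_iff_toReal_lt hat).1 ha
  have h1 := key ((a.toReal + γ) / 2) (by positivity) (by linarith)
  refine le_trans ?_ h1
  rw [← ENNReal.ofReal_toReal hat]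
  exact ENNReal.ofReal_le_ofReal (by rw [ENNReal.toReal_ofReal (by positivity)]; linarith)

/-! ### Power laws -/

/-- `μ` satisfies a power law with the given exponent `γ`. -/
def SatisfiesPowerLawWith (μ : Measure ℝ) (γ : ℝ) : Prop :=
  ∃ k₁ k₂ ρ₀ : ℝ, 0 < k₁ ∧ 0 < k₂ ∧ 0 < ρ₀ ∧
    ∀ x ∈ μ.support, ∀ ρ : ℝ, 0 < ρ → ρ < ρ₀ →
      ENNReal.ofReal (k₁ * ρ ^ γ) ≤ μ (Metric.closedBall x ρ) ∧
        μ (Metric.closedBall x ρ) ≤ ENNReal.ofReal (k₂ * ρ ^ γ)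

theorem satisfiesPowerLaw_iff {μ : Measure ℝ} :
    SatisfiesPowerLaw μ ↔ ∃ γ : ℝ, 0 < γ ∧ SatisfiesPowerLawWith μ γ :=
  ⟨fun ⟨γ, k₁, k₂, ρ₀, hγ, h⟩ => ⟨γ, hγ, k₁, k₂, ρ₀, h⟩,
    fun ⟨γ, hγ, k₁, k₂, ρ₀, h⟩ => ⟨γ, k₁, k₂, ρ₀, hγ, h⟩⟩

theorem SatisfiesPowerLawWith.isAbsolutelyDecayingWith {μ : Measure ℝ} [IsLocallyFiniteMeasure μ]
    {γ : ℝ} (hγ : 0 < γ) (h : SatisfiesPowerLawWith μ γ) :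
    ∃ C : ℝ, 0 < C ∧ IsAbsolutelyDecayingWith μ C γ := by
  obtain ⟨k₁, k₂, ρ₀, hk₁, hk₂, hρ₀, hμ⟩ := h
  refine ⟨k₂ * 2 ^ γ / k₁ + 2, by positivity, ρ₀ / 3, by positivity,
    fun ρ hρ hρ' x hx y ε hε => ?_⟩
  set B := Metric.closedBall x ρ with hB
  have hBpos : 0 < μ B := (μ.mem_support_iff_forall x).1 hx B (Metric.closedBall_mem_nhds x hρ)
  have hBfin : μ B ≠ ⊤ := (isCompact_closedBall x ρ).measure_lt_top.ne
  have hεγ : 0 < ε ^ γ := by positivity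
  have hlt : ∀ c : ℝ, 0 ≤ c → c < (k₂ * 2 ^ γ / k₁ + 2) * ε ^ γ → ENNReal.ofReal c * μ B <
      ENNReal.ofReal ((k₂ * 2 ^ γ / k₁ + 2) * ε ^ γ) * μ B := fun c hc hcc =>
    ENNReal.mul_lt_mul_left hBpos.ne' hBfin
      ((ENNReal.ofReal_lt_ofReal_iff (hc.trans_lt hcc)).2 hcc)
  rcases le_or_gt 1 ε with hε1 | hε1
  · have h1 : 1 ≤ ε ^ γ := Real.one_le_rpow hε1 hγ.le
    have h2 := hlt 1 zero_le_one (by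
      have : 0 < k₂ * 2 ^ γ / k₁ := by positivity
      nlinarith)
    rw [ENNReal.ofReal_one, one_mul] at h2
    exact (measure_mono Set.inter_subset_left).trans_lt h2
  · refine lt_of_le_of_lt ?_ (hlt (k₂ * 2 ^ γ / k₁ * ε ^ γ) (by positivity) (by nlinarith))
    rcases (Metric.closedBall y (ε * ρ) ∩ μ.support).eq_empty_or_nonempty with hemp | ⟨y', hy', hyK⟩
    · have h1 : μ (Metric.closedBall y (ε * ρ)) = 0 := by
        by_contra hne
        have := Measure.nonempty_inter_support_of_pos (pos_iff_ne_zero.2 hne)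
        rw [hemp] at this
        exact Set.not_nonempty_empty this
      rw [measure_mono_null Set.inter_subset_right h1]
      exact zero_le
    · -- Re-centre the small ball at a point of the support, at the cost of doubling its radius.
      have hsub : Metric.closedBall y (ε * ρ) ⊆ Metric.closedBall y' (2 * (ε * ρ)) := by
        refine Metric.closedBall_subset_closedBall' ?_
        rw [Metric.mem_closedBall, dist_comm] at hy'
        linarith
      calc μ (B ∩ Metric.closedBall y (ε * ρ)) ≤ μ (Metric.closedBall y' (2 * (ε * ρ))) :=
            measure_mono (Set.inter_subset_right.trans hsub)
        _ ≤ ENNReal.ofReal (k₂ * (2 * (ε * ρ)) ^ γ) :=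
            (hμ y' hyK _ (by positivity) (by nlinarith)).2
        _ = ENNReal.ofReal (k₂ * 2 ^ γ / k₁ * ε ^ γ) * ENNReal.ofReal (k₁ * ρ ^ γ) := by
            rw [← ENNReal.ofReal_mul (by positivity),
              Real.mul_rpow (by norm_num) (by positivity), Real.mul_rpow hε.le hρ.le]
            congr 1
            field_simp
        _ ≤ _ := by
            gcongr
            exact (hμ x hx ρ hρ (by linarith)).1

/-- A set on which balls of radius `δ` have mass at least `a` has a `2 δ`-net of cardinality at
most `μ U / a`, where `U` contains all those balls. -/
theorem exists_net_card_mul_le {μ : Measure ℝ} {A U : Set ℝ} {a : ENNReal} (ha0 : a ≠ 0)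
    (ha : a ≠ ⊤) (hU : μ U ≠ ⊤) {δ : ℝ} (hδ : 0 < δ)
    (hA : ∀ x ∈ A, a ≤ μ (Metric.closedBall x δ)) (hAU : ∀ x ∈ A, Metric.closedBall x δ ⊆ U) :
    ∃ F : Finset ℝ, A ⊆ ⋃ f ∈ F, Metric.closedBall f (2 * δ) ∧
      (F.card : ENNReal) * a ≤ μ U := by
  set P : Finset ℝ → Prop := fun F => (∀ f ∈ F, f ∈ A) ∧
    ∀ f ∈ F, ∀ f' ∈ F, f ≠ f' → 2 * δ < |f - f'| with hP
  have hcard : ∀ F, P F → (F.card : ENNReal) * a ≤ μ U := by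
    rintro F ⟨hFA, hF⟩
    have hdisj : (F : Set ℝ).PairwiseDisjoint fun f => Metric.closedBall f δ := by
      intro f hf f' hf' hne
      refine Metric.closedBall_disjoint_closedBall ?_
      rw [Real.dist_eq]
      linarith [hF f hf f' hf' hne]
    calc (F.card : ENNReal) * a = ∑ _f ∈ F, a := by rw [Finset.sum_const, nsmul_eq_mul]
      _ ≤ ∑ f ∈ F, μ (Metric.closedBall f δ) :=
        Finset.sum_le_sum fun f hf => hA f (hFA f hf)
      _ = μ (⋃ f ∈ F, Metric.closedBall f δ) :=
        (measure_biUnion_finset hdisj fun f _ => Metric.isClosed_closedBall.measurableSet).symm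
      _ ≤ μ U := measure_mono (Set.iUnion₂_subset fun f hf => hAU f (hFA f hf))
  have hbdd : BddAbove {m : ℕ | ∃ F, P F ∧ F.card = m} := by
    obtain ⟨m, hm⟩ := ENNReal.exists_nat_gt (ENNReal.div_lt_top hU ha0).ne
    refine ⟨m, ?_⟩
    rintro _ ⟨F, hF, rfl⟩
    have h1 : (F.card : ENNReal) ≤ μ U / a :=
      (ENNReal.le_div_iff_mul_le (Or.inl ha0) (Or.inl ha)).2 (hcard F hF)
    exact_mod_cast (h1.trans_lt hm).le
  -- A separated set of maximal cardinality is automatically a `2 δ`-net.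
  obtain ⟨F, hPF, hFmax⟩ := Nat.sSup_mem
    (s := {m : ℕ | ∃ F, P F ∧ F.card = m}) ⟨0, ∅, by simp [hP], rfl⟩ hbdd
  refine ⟨F, fun x hx => ?_, hcard F hPF⟩
  by_contra hcon
  have hfar : ∀ f ∈ F, 2 * δ < |x - f| := by
    intro f hf
    by_contra! hle
    exact hcon (Set.mem_biUnion hf (by rwa [Metric.mem_closedBall, Real.dist_eq]))
  have hxF : x ∉ F := fun hxF => by
    have := hfar x hxF
    rw [sub_self, abs_zero] at this
    linarith
  have hPi : P (insert x F) := by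
    refine ⟨fun f hf => ?_, fun f hf f' hf' hne => ?_⟩
    · rcases Finset.mem_insert.1 hf with rfl | hfF
      exacts [hx, hPF.1 f hfF]
    · rcases Finset.mem_insert.1 hf with rfl | hfF <;>
        rcases Finset.mem_insert.1 hf' with rfl | hfF'
      · exact (hne rfl).elim
      · exact hfar f' hfF'
      · rw [abs_sub_comm]
        exact hfar f hfF
      · exact hPF.2 f hfF f' hfF' hne
  have h1 := le_csSup hbdd ⟨_, hPi, rfl⟩
  rw [Finset.card_insert_of_notMem hxF, ← hFmax] at h1
  omega

/-- The upper dimension bound, by packing: disjoint balls of radius `δ` centred in a bounded part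
of the support number at most a constant times `δ ^ (-γ)`, and their enlargements cover. -/
theorem SatisfiesPowerLawWith.dimH_support_le {μ : Measure ℝ} [IsLocallyFiniteMeasure μ]
    {γ : ℝ} (hγ : 0 < γ) (h : SatisfiesPowerLawWith μ γ) :
    dimH μ.support ≤ ENNReal.ofReal γ := by
  obtain ⟨k₁, k₂, ρ₀, hk₁, hk₂, hρ₀, hμ⟩ := h
  have hpiece : ∀ n : ℕ, dimH (μ.support ∩ Metric.closedBall 0 n) ≤ ENNReal.ofReal γ := by
    intro n
    set A := μ.support ∩ Metric.closedBall (0 : ℝ) n with hA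
    set M := μ (Metric.closedBall 0 (n + 1)) with hM
    have hMfin : M ≠ ⊤ := (isCompact_closedBall _ _).measure_lt_top.ne
    have hcov : ∀ δ : ℝ, 0 < δ → δ < ρ₀ → δ ≤ 1 → ∃ F : Finset ℝ,
        A ⊆ ⋃ f ∈ F, Metric.closedBall f (2 * δ) ∧
        (F.card : ENNReal) * ENNReal.ofReal (k₁ * δ ^ γ) ≤ M := by
      intro δ hδ hδρ hδ1
      refine exists_net_card_mul_le (ENNReal.ofReal_pos.2 (by positivity)).ne'
        ENNReal.ofReal_ne_top hMfin hδ (fun x hx => (hμ x hx.1 δ hδ hδρ).1) fun x hx => ?_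
      refine Metric.closedBall_subset_closedBall' ?_
      have := Metric.mem_closedBall.1 hx.2
      linarith
    set τ : ℝ := min ρ₀ 1 with hτ
    have hτ0 : 0 < τ := lt_min hρ₀ one_pos
    have hδ : ∀ j : ℕ, 0 < τ / (j + 2) ∧ τ / (j + 2) < ρ₀ ∧ τ / (j + 2) ≤ 1 := by
      intro j
      have h1 : τ / (j + 2) < τ := div_lt_self hτ0 (by
        have : (0 : ℝ) ≤ j := j.cast_nonneg
        linarith)
      exact ⟨by positivity, h1.trans_le (min_le_left _ _), h1.le.trans (min_le_right _ _)⟩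
    choose F hFA hFM using fun j => hcov _ (hδ j).1 (hδ j).2.1 (hδ j).2.2
    have hr : Tendsto (fun j : ℕ => ENNReal.ofReal (4 * (τ / (j + 2)))) atTop (𝓝 0) := by
      rw [← ENNReal.ofReal_zero]
      refine ENNReal.tendsto_ofReal ?_
      have h1 : Tendsto (fun j : ℕ => τ / ((j : ℝ) + 2)) atTop (𝓝 0) :=
        tendsto_const_nhds.div_atTop
          (tendsto_atTop_add_const_right _ _ tendsto_natCast_atTop_atTop)
      simpa using h1.const_mul 4
    have hdiam : ∀ (j : ℕ) (i : F j), Metric.ediam (Metric.closedBall (i : ℝ) (2 * (τ / (j + 2)))) ≤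
        ENNReal.ofReal (4 * (τ / (j + 2))) := by
      intro j i
      have h0 := (hδ j).1
      rw [Real.closedBall_eq_Icc, Real.ediam_Icc]
      exact ENNReal.ofReal_le_ofReal (by linarith)
    have hH := Measure.hausdorffMeasure_le_liminf_sum (ι := fun j => F j) γ A
      (fun j : ℕ => ENNReal.ofReal (4 * (τ / (j + 2)))) hr
      (fun j i => Metric.closedBall (i : ℝ) (2 * (τ / (j + 2))))
      (Eventually.of_forall hdiam) (Eventually.of_forall fun j x hx => by
        obtain ⟨f, hf, hxf⟩ := Set.mem_iUnion₂.1 (hFA j hx)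
        exact Set.mem_iUnion.2 ⟨⟨f, hf⟩, hxf⟩)
    have hbound : ∀ j : ℕ, ∑ i : F j, Metric.ediam
        (Metric.closedBall (i : ℝ) (2 * (τ / (j + 2)))) ^ γ ≤ M * ENNReal.ofReal (4 ^ γ / k₁) := by
      intro j
      have h0 := (hδ j).1
      calc ∑ i : F j, Metric.ediam (Metric.closedBall (i : ℝ) (2 * (τ / (j + 2)))) ^ γ
          ≤ ∑ _i : F j, ENNReal.ofReal (4 * (τ / (j + 2))) ^ γ :=
            Finset.sum_le_sum fun i _ => ENNReal.rpow_le_rpow (hdiam j i) hγ.le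
        _ = (F j).card * ENNReal.ofReal (k₁ * (τ / (j + 2)) ^ γ) * ENNReal.ofReal (4 ^ γ / k₁) := by
            rw [Finset.sum_const, Finset.card_univ, Fintype.card_coe, nsmul_eq_mul, mul_assoc,
              ← ENNReal.ofReal_mul (by positivity), ENNReal.ofReal_rpow_of_pos (by positivity),
              Real.mul_rpow (by norm_num) h0.le]
            congr 2
            field_simp
        _ ≤ _ := by
            gcongr
            exact hFM j
    have hlt : Measure.hausdorffMeasure γ A ≠ ⊤ := by
      refine ne_top_of_le_ne_top
        (ENNReal.mul_ne_top hMfin (ENNReal.ofReal_ne_top (r := 4 ^ γ / k₁))) (hH.trans ?_)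
      exact (liminf_le_liminf (Eventually.of_forall hbound)).trans (liminf_const _).le
    refine dimH_le_of_hausdorffMeasure_ne_top (d := γ.toNNReal) ?_
    rwa [Real.coe_toNNReal _ hγ.le]
  have hU : μ.support = ⋃ n : ℕ, μ.support ∩ Metric.closedBall 0 n := by
    rw [← Set.inter_iUnion, Metric.iUnion_closedBall_nat, Set.inter_univ]
  rw [hU, dimH_iUnion]
  exact iSup_le hpiece

/-- Under a power law with exponent `γ`, both the support and its part in `badBoundedRunsSet` have
dimension `γ`. -/
theorem SatisfiesPowerLawWith.dimH_eq {μ : Measure ℝ} [IsLocallyFiniteMeasure μ] (hμ : μ ≠ 0)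
    {γ : ℝ} (hγ : 0 < γ) (h : SatisfiesPowerLawWith μ γ) :
    dimH μ.support = ENNReal.ofReal γ ∧
      dimH (μ.support ∩ badBoundedRunsSet) = ENNReal.ofReal γ := by
  obtain ⟨C, hC, hdec⟩ := h.isAbsolutelyDecayingWith hγ
  have h1 := hdec.le_dimH hμ hC hγ
  have h2 := h.dimH_support_le hγ
  have h3 : dimH (μ.support ∩ badBoundedRunsSet) ≤ dimH μ.support := dimH_mono Set.inter_subset_left
  exact ⟨le_antisymm h2 (h1.trans h3), le_antisymm (h3.trans h2) h1⟩

/-! ### The Cantor measure -/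

/-- The parametrization of the middle third Cantor set by binary sequences: `false` and `true`
become the ternary digits `0` and `2`. -/
noncomputable def cantorPoint (u : ℕ → Bool) : ℝ :=
  Real.ofDigits (fun i => cond (u i) (2 : Fin 3) 0)

theorem continuous_cantorPoint : Continuous cantorPoint :=
  Real.continuous_ofDigits.comp (by fun_prop)

theorem range_cantorPoint : Set.range cantorPoint = cantorSet := by
  ext x
  constructor
  · rintro ⟨u, rfl⟩
    exact ofDigits_bool_to_fin_three_mem_cantorSet u
  · intro hx
    obtain ⟨u, hu⟩ := cantorSetEquivNatToBool.symm.surjective ⟨x, hx⟩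
    exact ⟨u, congrArg Subtype.val hu⟩

theorem abs_cantorPoint_sub_le {u v : ℕ → Bool} {n : ℕ} (h : ∀ i < n, u i = v i) :
    |cantorPoint u - cantorPoint v| ≤ (1 / 3) ^ n := by
  have := Real.abs_ofDigits_sub_ofDigits_le (b := 3) (n := n)
    (x := fun i => cond (u i) (2 : Fin 3) 0) (y := fun i => cond (v i) (2 : Fin 3) 0)
    (fun i hi => by simp only [h i hi])
  simpa [cantorPoint] using this

theorem cantorPoint_eq_head_add (u : ℕ → Bool) :
    cantorPoint u = cond (u 0) (2 / 3) 0 + 1 / 3 * cantorPoint fun i => u (i + 1) := by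
  rw [cantorPoint, Real.ofDigits_eq_sum_add_ofDigits _ 1, cantorPoint]
  cases h : u 0
  · simp [Real.ofDigitsTerm, h]
  · simp [Real.ofDigitsTerm, h]
    norm_num

theorem cantorPoint_mem_Icc (u : ℕ → Bool) : cantorPoint u ∈ Set.Icc (0 : ℝ) 1 :=
  ⟨Real.ofDigits_nonneg _, Real.ofDigits_le_one _⟩

theorem le_abs_cantorPoint_sub {n : ℕ} : ∀ {u v : ℕ → Bool}, (∀ i < n, u i = v i) → u n ≠ v n →
    (1 / 3 : ℝ) ^ (n + 1) ≤ |cantorPoint u - cantorPoint v| := by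
  induction n with
  | zero =>
    intro u v _ hne
    have hu := cantorPoint_mem_Icc fun i => u (i + 1)
    have hv := cantorPoint_mem_Icc fun i => v (i + 1)
    rw [cantorPoint_eq_head_add u, cantorPoint_eq_head_add v]
    rw [Set.mem_Icc] at hu hv
    cases h1 : u 0 <;> cases h2 : v 0
    · simp [h1, h2] at hne
    · refine le_trans ?_ (neg_le_abs _)
      simp only [cond_true, cond_false]
      linarith
    · refine le_trans ?_ (le_abs_self _)
      simp only [cond_true, cond_false]
      linarith
    · simp [h1, h2] at hne
  | succ n ih =>
    intro u v h hne
    have h1 := ih (u := fun i => u (i + 1)) (v := fun i => v (i + 1))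
      (fun i hi => h (i + 1) (by omega)) hne
    rw [cantorPoint_eq_head_add u, cantorPoint_eq_head_add v, h 0 (by omega), add_sub_add_left_eq_sub,
      ← mul_sub, abs_mul, abs_of_pos (by norm_num : (0 : ℝ) < 1 / 3), pow_succ']
    gcongr

/-- The fair coin-tossing measure on binary sequences. -/
noncomputable def coinMeasure : Measure (ℕ → Bool) :=
  Measure.infinitePi fun _ => (PMF.uniformOfFintype Bool).toMeasure

instance : IsProbabilityMeasure coinMeasure := by
  unfold coinMeasure; infer_instance

theorem coinMeasure_cylinder (u : ℕ → Bool) (n : ℕ) :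
    coinMeasure {v | ∀ i < n, v i = u i} = ENNReal.ofReal ((1 / 2) ^ n) := by
  have h : {v : ℕ → Bool | ∀ i < n, v i = u i} =
      Set.pi (Finset.range n : Set ℕ) fun i => {u i} := by
    ext v; simp [Set.mem_pi]
  rw [h, coinMeasure, Measure.infinitePi_pi _ (fun i _ => measurableSet_singleton _)]
  simp only [PMF.toMeasure_apply_singleton _ _ (measurableSet_singleton _),
    PMF.uniformOfFintype_apply, Fintype.card_bool, Finset.prod_const, Finset.card_range]
  rw [ENNReal.ofReal_pow (by norm_num), one_div, ENNReal.ofReal_inv_of_pos (by norm_num)]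
  norm_num

/-- The Cantor measure: the law of a random point of the Cantor set with independent fair
ternary digits `0` and `2`. -/
noncomputable def cantorMeasure : Measure ℝ := coinMeasure.map cantorPoint

instance : IsProbabilityMeasure cantorMeasure :=
  Measure.isProbabilityMeasure_map continuous_cantorPoint.measurable.aemeasurable

theorem cantorMeasure_closedBall (x ρ : ℝ) :
    cantorMeasure (Metric.closedBall x ρ) = coinMeasure {v | |cantorPoint v - x| ≤ ρ} := by
  rw [cantorMeasure, Measure.map_apply continuous_cantorPoint.measurable
    Metric.isClosed_closedBall.measurableSet]
  rfl

theorem le_cantorMeasure_closedBall (u : ℕ → Bool) {ρ : ℝ} {n : ℕ} (h : (1 / 3) ^ n ≤ ρ) :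
    ENNReal.ofReal ((1 / 2) ^ n) ≤ cantorMeasure (Metric.closedBall (cantorPoint u) ρ) := by
  rw [cantorMeasure_closedBall, ← coinMeasure_cylinder u n]
  exact measure_mono fun v hv => (abs_cantorPoint_sub_le hv).trans h

theorem cantorMeasure_closedBall_le (u : ℕ → Bool) {ρ : ℝ} {n : ℕ} (h : ρ < (1 / 3) ^ n) :
    cantorMeasure (Metric.closedBall (cantorPoint u) ρ) ≤ ENNReal.ofReal ((1 / 2) ^ n) := by
  rw [cantorMeasure_closedBall, ← coinMeasure_cylinder u n]
  refine measure_mono fun v hv => ?_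
  by_contra hne
  simp only [Set.mem_ofPred_eq, not_forall] at hne hv
  obtain ⟨i, hi, hiv⟩ := hne
  have hex : ∃ k, v k ≠ u k := ⟨i, hiv⟩
  have h1 := le_abs_cantorPoint_sub (fun i hi => by simpa using Nat.find_min hex hi)
    (Nat.find_spec hex)
  have h2 : Nat.find hex + 1 ≤ n := (Nat.find_min' hex hiv).trans_lt hi
  have h3 : (1 / 3 : ℝ) ^ n ≤ (1 / 3) ^ (Nat.find hex + 1) :=
    pow_le_pow_of_le_one (by norm_num) (by norm_num) h2
  linarith

theorem support_cantorMeasure : cantorMeasure.support = cantorSet := by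
  refine subset_antisymm (Measure.support_subset_of_isClosed isClosed_cantorSet ?_) ?_
  · refine (ae_map_iff continuous_cantorPoint.measurable.aemeasurable
      isClosed_cantorSet.measurableSet).2 (Eventually.of_forall fun u => ?_)
    exact range_cantorPoint.subset (Set.mem_range_self u)
  · rw [← range_cantorPoint]
    rintro _ ⟨u, rfl⟩
    refine Metric.nhds_basis_closedBall.mem_measureSupport.2 fun ρ hρ => ?_
    obtain ⟨n, hn⟩ := exists_pow_lt_of_lt_one hρ (by norm_num : (1 / 3 : ℝ) < 1)
    exact (ENNReal.ofReal_pos.2 (by positivity)).trans_le (le_cantorMeasure_closedBall u hn.le)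

theorem satisfiesPowerLawWith_cantorMeasure :
    SatisfiesPowerLawWith cantorMeasure (Real.log 2 / Real.log 3) := by
  set γ := Real.log 2 / Real.log 3 with hγ
  have hγ0 : 0 < γ := div_pos (Real.log_pos (by norm_num)) (Real.log_pos (by norm_num))
  have h13 : (1 / 3 : ℝ) ^ γ = 1 / 2 := by
    have h3 : Real.log 3 ≠ 0 := (Real.log_pos (by norm_num)).ne'
    rw [Real.rpow_def_of_pos (by norm_num), one_div, Real.log_inv, hγ, neg_mul,
      mul_div_cancel₀ _ h3, Real.exp_neg, Real.exp_log (by norm_num), one_div]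
  have hpow : ∀ n : ℕ, ((1 / 3 : ℝ) ^ n) ^ γ = (1 / 2) ^ n := fun n => by
    rw [← Real.rpow_natCast, ← Real.rpow_mul (by norm_num), mul_comm, Real.rpow_mul (by norm_num),
      h13, Real.rpow_natCast]
  refine ⟨1 / 2, 4, 1, by norm_num, by norm_num, one_pos, fun x hx ρ hρ hρ1 => ?_⟩
  rw [support_cantorMeasure, ← range_cantorPoint] at hx
  obtain ⟨u, rfl⟩ := hx
  obtain ⟨n, hn, hn'⟩ := exists_nat_pow_near_of_lt_one hρ hρ1.le
    (by norm_num : (0 : ℝ) < 1 / 3) (by norm_num)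
  constructor
  · refine le_trans (ENNReal.ofReal_le_ofReal ?_) (le_cantorMeasure_closedBall u hn.le)
    calc 1 / 2 * ρ ^ γ ≤ 1 / 2 * ((1 / 3 : ℝ) ^ n) ^ γ := by gcongr
      _ = (1 / 2) ^ (n + 1) := by rw [hpow, pow_succ']
  · -- One level is given up, since `ρ` may equal the gap `(1 / 3) ^ n`.
    have hupper : cantorMeasure (Metric.closedBall (cantorPoint u) ρ) ≤
        ENNReal.ofReal (2 * (1 / 2) ^ n) := by
      rcases n with _ | n
      · refine prob_le_one.trans (ENNReal.one_le_ofReal.2 (by norm_num))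
      · refine (cantorMeasure_closedBall_le u (n := n) (hn'.trans_lt ?_)).trans
          (ENNReal.ofReal_le_ofReal (le_of_eq (by rw [pow_succ']; ring)))
        exact pow_lt_pow_right_of_lt_one₀ (by norm_num) (by norm_num) (Nat.lt_succ_self n)
    refine hupper.trans (ENNReal.ofReal_le_ofReal ?_)
    calc 2 * (1 / 2 : ℝ) ^ n = 4 * ((1 / 3 : ℝ) ^ (n + 1)) ^ γ := by rw [hpow, pow_succ']; ring
      _ ≤ 4 * ρ ^ γ := by gcongr

/-! ### Numbers normal to no base -/

/-- Bounded runs exclude normality: a block of zeros longer than all runs never occurs, so its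
frequency is `0`. -/
theorem badBoundedRunsSet_subset_normalToNoBaseSet : badBoundedRunsSet ⊆ normalToNoBaseSet := by
  rintro x ⟨-, hx⟩ b _ hb hnorm
  obtain ⟨L, hL⟩ := hx b hb
  have h1 := hnorm (L + 1) (by omega) fun _ => 0
  have h2 : ∀ n, ¬ ∀ i : Fin (L + 1), expansionDigits x b (n + i) = 0 := by
    intro n hn
    have h0 := hn 0
    rw [Fin.val_zero, add_zero] at h0
    have := hL n (L + 1) fun i hi => (hn ⟨i, hi⟩).trans h0.symm
    omega
  simp only [h2, Finset.filter_false, Finset.card_empty, Nat.cast_zero, zero_div] at h1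
  have h3 := tendsto_nhds_unique h1 tendsto_const_nhds
  have hb0 : (b : ℝ) ≠ 0 := by exact_mod_cast NeZero.ne b
  exact one_div_ne_zero (pow_ne_zero _ hb0) h3

theorem mainTheorem4 :
    -- positive dimension on the support of an absolutely decaying measure
    (∀ μ : Measure ℝ, IsLocallyFiniteMeasure μ → μ ≠ 0 → IsAbsolutelyDecaying μ →
      0 < dimH (μ.support ∩ badBoundedRunsSet)) ∧
    -- full dimension under a power law
    (∀ μ : Measure ℝ, IsLocallyFiniteMeasure μ → SatisfiesPowerLaw μ →
      dimH (μ.support ∩ badBoundedRunsSet) = dimH μ.support) ∧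
    -- the middle third Cantor set
    (∃ μ : Measure ℝ, IsLocallyFiniteMeasure μ ∧ SatisfiesPowerLaw μ ∧
      μ.support = cantorSet) ∧
    dimH (cantorSet ∩ badBoundedRunsSet) = ENNReal.ofReal (Real.log 2 / Real.log 3) ∧
    dimH (cantorSet ∩ normalToNoBaseSet) = ENNReal.ofReal (Real.log 2 / Real.log 3) := by
  have hγ : 0 < Real.log 2 / Real.log 3 :=
    div_pos (Real.log_pos (by norm_num)) (Real.log_pos (by norm_num))
  obtain ⟨hC, hCS⟩ := satisfiesPowerLawWith_cantorMeasure.dimH_eq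
    (IsProbabilityMeasure.ne_zero cantorMeasure) hγ
  rw [support_cantorMeasure] at hC hCS
  refine ⟨?_, ?_, ⟨cantorMeasure, inferInstance,
    satisfiesPowerLaw_iff.2 ⟨_, hγ, satisfiesPowerLawWith_cantorMeasure⟩,
    support_cantorMeasure⟩, hCS, ?_⟩
  · rintro μ _ hμ ⟨C, γ, hC0, hγ0, h⟩
    exact (ENNReal.ofReal_pos.2 hγ0).trans_le (h.le_dimH hμ hC0 hγ0)
  · intro μ _ h
    obtain ⟨γ, hγ0, hlaw⟩ := satisfiesPowerLaw_iff.1 h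
    rcases eq_or_ne μ 0 with rfl | hμ
    · simp
    · obtain ⟨h1, h2⟩ := hlaw.dimH_eq hμ hγ0
      rw [h1, h2]
  · refine le_antisymm (hC ▸ dimH_mono Set.inter_subset_left) (hCS ▸ dimH_mono ?_)
    exact Set.inter_subset_inter_right _ badBoundedRunsSet_subset_normalToNoBaseSet
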